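/- Let $\mathcal A$ be an abelian length category, that is, an abelian category in which every object has a composition series. Subcategories are full and closed under isomorphisms. Let $\operatorname{tors}\mathcal A$ be the complete lattice, ordered by inclusion, of torsion classes of $\mathcal A$ (subcategories containing $0$ and closed under quotients and extensions); for a collection $\mathcal C$ of objects, let $T(\mathcal C)$ be the smallest torsion class containing $\mathcal C$ and ${}^{\perp}\mathcal C=\{M \mid \operatorname{Hom}(M,X)=0 \text{ for all } X\in\mathcal C\}$. A wide subcategory is a subcategory containing $0$ and closed under extensions, kernels and cokernels. A brick is an object whose endomorphism ring is a division ring, and a semibrick is a set of isomorphism classes of bricks with no non-zero morphisms between distinct members. Let $\operatorname{wide}\mathcal A$ and $\operatorname{sbrick}\mathcal A$ be the sets of wide subcategories and of semibricks. $\operatorname{Filt}\mathcal S$ is the subcategory of objects with a finite filtration whose subquotients lie in $\mathcal S$, and $\operatorname{simp}\mathcal W$ is the set of isomorphism classes of simple objects of the abelian category $\mathcal W$. In a complete lattice $L$, a canonical join representation of $x$ is an antichain $A=\mathrm{CJR}(x)$ with $x=\bigvee A$ such that whenever $x=\bigvee B$, every $a\in A$ satisfies $a\le b$ for some $b\in B$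 (such an $A$ is unique if it exists, and its members are completely join-irreducible); the canonical meet representation $\mathrm{CMR}(x)$ is defined dually. Let $L_0$ and $L^0$ be the sets of elements having a canonical join representation and a canonical meet representation, respectively. For a completely join-irreducible $j$ put $j_*=\bigvee\{x\mid x<j\}$ and $\kappa(j)=\max\{x\mid j\wedge x=j_*\}$, and for $x\in L_0$ put $\bar\kappa(x)=\bigwedge\{\kappa(j)\mid j\in \mathrm{CJR}(x)\}$. For $L=\operatorname{tors}\mathcal A$, let $\overline{\mathrm{CJR}}(\mathcal T)$ be the set of isomorphism classes of bricks $B$ with $T(B)\in\mathrm{CJR}(\mathcal T)$, for $\mathcal T\in L_0$, and let $\overline{\mathrm{CMR}}(\mathcal T)$ be the set of isomorphism classes of bricks $B$ with ${}^{\perp}B\in\mathrm{CMR}(\mathcal T)$, for $\mathcal T\in L^0$. Then for $L=\operatorname{tors}\mathcal A$ the maximum defining $\kappa(j)$ exists for every completely join-irreducible $j$, and: 1. $\bar\kappa$ is a bijection $(\operatorname{tors}\mathcal A)_0\to(\operatorname{tors}\mathcal A)^0$. 2. $T:\operatorname{sbrick}\mathcal A\to(\operatorname{tors}\mathcal A)_0$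 and $\overline{\mathrm{CJR}}$ are mutually inverse bijections; ${}^{\perp}(-):\operatorname{sbrick}\mathcal A\to(\operatorname{tors}\mathcal A)^0$ and $\overline{\mathrm{CMR}}$ are mutually inverse bijections; $\operatorname{Filt}:\operatorname{sbrick}\mathcal A\to\operatorname{wide}\mathcal A$ and $\operatorname{simp}$ are mutually inverse bijections; and $T:\operatorname{wide}\mathcal A\to(\operatorname{tors}\mathcal A)_0$ and ${}^{\perp}(-):\operatorname{wide}\mathcal A\to(\operatorname{tors}\mathcal A)^0$ are bijections. 3. These maps commute: for $\mathcal S\in\operatorname{sbrick}\mathcal A$ and $\mathcal W\in\operatorname{wide}\mathcal A$ we have $T(\operatorname{Filt}\mathcal S)=T(\mathcal S)$, ${}^{\perp}(\operatorname{Filt}\mathcal S)={}^{\perp}\mathcal S$, $T(\operatorname{simp}\mathcal W)=T(\mathcal W)$ and ${}^{\perp}(\operatorname{simp}\mathcal W)={}^{\perp}\mathcal W$; and for $\mathcal T\in(\operatorname{tors}\mathcal A)_0$ we have $\bar\kappa(\mathcal T)={}^{\perp}\bigl(\overline{\mathrm{CJR}}(\mathcal T)\bigr)$ and $\overline{\mathrm{CMR}}(\bar\kappa(\mathcal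 T))=\overline{\mathrm{CJR}}(\mathcal T)$. In particular $\bar\kappa(T(\mathcal S))={}^{\perp}\mathcal S$ for every semibrick $\mathcal S$, and $\bar\kappa(T(\mathcal W))={}^{\perp}\mathcal W$ for every wide subcategory $\mathcal W$. -/

import Mathlib

open CategoryTheory CategoryTheory.Limits ZeroObject

universe v u

namespace TorsKappa

/-! ### Canonical representations and the kappa map in a complete lattice -/

section Lattice

variable {L : Type*} [CompleteLattice L]

/-- `j` is completely join-irreducible: `j = ⋁ X` implies `j ∈ X`. -/
def IsCompletelyJoinIrreducible (j : L) : Prop :=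
  ∀ X : Set L, j = sSup X → j ∈ X

/-- The element `j_* = ⋁ {x | x < j}`. -/
def lowerStar (j : L) : L := sSup {x | x < j}

/-- The kappa map `κ(j) = max {x | j ∧ x = j_*}` (for completely join-irreducible `j`). The maximum,
when it exists, is the supremum. -/
def kappa (j : L) : L := sSup {x | j ⊓ x = lowerStar j}

/-- `x = ⋁ A` is a canonical join representation: `A` is an antichain refining every join
representation of `x`. -/
structure IsCanonicalJoinRep (x : L) (A : Set L) : Prop where
  eq_sSup : x = sSup A
  refines : ∀ B : Set L, x = sSup B → ∀ a ∈ A, ∃ b ∈ B, a ≤ b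
  antichain : ∀ a₁ ∈ A, ∀ a₂ ∈ A, a₁ ≤ a₂ → a₁ = a₂

/-- `x = ⋀ A` is a canonical meet representation. -/
structure IsCanonicalMeetRep (x : L) (A : Set L) : Prop where
  eq_sInf : x = sInf A
  refines : ∀ B : Set L, x = sInf B → ∀ a ∈ A, ∃ b ∈ B, b ≤ a
  antichain : ∀ a₁ ∈ A, ∀ a₂ ∈ A, a₁ ≤ a₂ → a₁ = a₂

theorem IsCanonicalJoinRep.unique {x : L} {A B : Set L} (hA : IsCanonicalJoinRep x A)
    (hB : IsCanonicalJoinRep x B) : A = B := by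
  have key : ∀ {A B : Set L}, IsCanonicalJoinRep x A → IsCanonicalJoinRep x B → A ⊆ B := by
    intro A B hA hB a ha
    obtain ⟨b, hb, hab⟩ := hA.refines B hB.eq_sSup a ha
    obtain ⟨a', ha', hba'⟩ := hB.refines A hA.eq_sSup b hb
    obtain rfl := hA.antichain a ha a' ha' (hab.trans hba')
    rwa [le_antisymm hab hba']
  exact Set.Subset.antisymm (key hA hB) (key hB hA)

theorem IsCanonicalMeetRep.unique {x : L} {A B : Set L} (hA : IsCanonicalMeetRep x A)
    (hB : IsCanonicalMeetRep x B) : A = B := by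
  have key : ∀ {A B : Set L}, IsCanonicalMeetRep x A → IsCanonicalMeetRep x B → A ⊆ B := by
    intro A B hA hB a ha
    obtain ⟨b, hb, hab⟩ := hA.refines B hB.eq_sInf a ha
    obtain ⟨a', ha', hba'⟩ := hB.refines A hA.eq_sInf b hb
    obtain rfl := hA.antichain a' ha' a ha (hba'.trans hab)
    rwa [le_antisymm hba' hab]
  exact Set.Subset.antisymm (key hA hB) (key hB hA)

variable (L) in
/-- `L_0`: the elements having a canonical join representation. -/
def lowerZero : Set L := {x | ∃ A, IsCanonicalJoinRep x A}

variable (L) in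
/-- `L^0`: the elements having a canonical meet representation. -/
def upperZero : Set L := {x | ∃ A, IsCanonicalMeetRep x A}

/-- `CJR(x)`: the members of the canonical join representation of `x` (for `x ∈ L_0`). -/
def CJR (x : L) : Set L := {a | ∃ A, IsCanonicalJoinRep x A ∧ a ∈ A}

/-- `CMR(x)`: the members of the canonical meet representation of `x` (for `x ∈ L^0`). -/
def CMR (x : L) : Set L := {a | ∃ A, IsCanonicalMeetRep x A ∧ a ∈ A}

theorem IsCanonicalJoinRep.cjr_eq {x : L} {A : Set L} (hA : IsCanonicalJoinRep x A) :
    CJR x = A :=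
  Set.ext fun _ => ⟨fun ⟨_, hB, h⟩ => hB.unique hA ▸ h, fun h => ⟨A, hA, h⟩⟩

theorem IsCanonicalMeetRep.cmr_eq {x : L} {A : Set L} (hA : IsCanonicalMeetRep x A) :
    CMR x = A :=
  Set.ext fun _ => ⟨fun ⟨_, hB, h⟩ => hB.unique hA ▸ h, fun h => ⟨A, hA, h⟩⟩

/-- Members of a canonical join representation are completely join-irreducible, so that `kappa`
is applied only to such elements in the extended kappa map. -/
theorem IsCanonicalJoinRep.irreducible {x : L} {A : Set L} (hA : IsCanonicalJoinRep x A) {a : L}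
    (ha : a ∈ A) : IsCompletelyJoinIrreducible a := by
  intro B hB
  have hx : x = sSup (B ∪ (A \ {a})) := by
    rw [sSup_union, ← hB, ← sSup_insert, Set.insert_sdiff_singleton, Set.insert_eq_of_mem ha]
    exact hA.eq_sSup
  obtain ⟨b, hb | hb, hab⟩ := hA.refines _ hx a ha
  · have hba : b ≤ a := hB ▸ le_sSup hb
    rwa [le_antisymm hab hba]
  · exact absurd (hA.antichain a ha b hb.1 hab).symm hb.2

/-- The extended kappa map `x ↦ ⋀ {κ(j) | j ∈ CJR(x)}` (for `x ∈ L_0`). -/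
def extKappa (x : L) : L := sInf (kappa '' CJR x)

end Lattice

/-! ### Subcategories of an abelian category -/

section Category

variable (C : Type u) [Category.{v} C] [Abelian C]

/-- `C` is a length category: every object has a composition series, i.e. a finite chain of
subobjects from `0` to the whole object, each one maximal in the next. -/
def IsLengthCategory : Prop :=
  ∀ X : C, ∃ s : RelSeries {p : Subobject X × Subobject X | p.1 ⋖ p.2},
    s.head = ⊥ ∧ s.last = ⊤

variable {C}

/-- A torsion class: it contains the zero objects and is closed under quotients and extensions
(hence also under isomorphisms). -/
structure IsTorsionClass (P : ObjectProperty C) : Prop where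
  containsZero : P.ContainsZero
  quotients : P.IsClosedUnderQuotients
  extensions : P.IsClosedUnderExtensions

variable (C) in
/-- `tors C`, ordered by inclusion. -/
abbrev Tors : Type u := {P : ObjectProperty C // IsTorsionClass P}

/-- Torsion classes are closed under arbitrary intersections. -/
instance : InfSet (Tors C) where
  sInf X := ⟨fun M => ∀ T ∈ X, T.1 M,
    { containsZero := ⟨0, isZero_zero C, fun T _ => by
        have := T.2.containsZero
        have := T.2.quotients
        exact T.1.prop_zero⟩
      quotients := ⟨fun f _ h T hT => by
        have := T.2.quotients
        exact T.1.prop_of_epi f (h T hT)⟩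
      extensions := ⟨fun hS h₁ h₃ T hT => by
        have := T.2.extensions
        exact T.1.prop_X₂_of_shortExact hS (h₁ T hT) (h₃ T hT)⟩ }⟩

/-- The complete lattice `tors C`, whose meets are intersections. -/
instance : CompleteLattice (Tors C) :=
  completeLatticeOfInf (Tors C) fun _ =>
    ⟨fun T hT _ hM => hM T hT, fun _ hU M hM _ hT => hU hT M hM⟩

/-- The smallest torsion class containing `P`. -/
def torsClosure (P : ObjectProperty C) : Tors C := sInf {T | P ≤ T.1}

/-- The left Hom-orthogonal `⊥P = {M | Hom(M, X) = 0 for all X in P}`, which is a torsion class. -/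
def leftPerp (P : ObjectProperty C) : Tors C :=
  ⟨P.leftOrthogonal,
    { containsZero := inferInstance
      quotients := ⟨fun f _ h Y g hY => by
        rw [← cancel_epi f, comp_zero]
        exact h _ hY⟩
      extensions := ⟨fun {S} hS h₁ h₃ Y g hY => by
        have := hS.epi_g
        have h : S.f ≫ g = 0 := h₁ _ hY
        rw [← hS.exact.g_desc g h, h₃ (hS.exact.desc g h) hY, comp_zero]⟩ }⟩

/-- A brick: an object whose endomorphism ring is a division ring. -/
def IsBrick (B : C) : Prop :=
  Nontrivial (End B) ∧ ∀ f : End B, f ≠ 0 → IsUnit f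

/-- The isomorphism class of an object. -/
def isoClass (B : C) : ObjectProperty C := fun X => Nonempty (X ≅ B)

variable (C) in
/-- `sbrick C`: the semibricks. A set of isomorphism classes of objects is given as an
isomorphism-closed property of objects. -/
def sbrick : Set (ObjectProperty C) :=
  {S | S.IsClosedUnderIsomorphisms ∧ (∀ B, S B → IsBrick B) ∧
    ∀ B₁ B₂, S B₁ → S B₂ → ¬ Nonempty (B₁ ≅ B₂) → ∀ f : B₁ ⟶ B₂, f = 0}

variable (C) in
/-- `wide C`: the wide subcategories, i.e. the (nonempty, full, isomorphism-closed) subcategories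
closed under extensions, kernels and cokernels. -/
def wide : Set (ObjectProperty C) :=
  {W | W.IsClosedUnderIsomorphisms ∧ W.ContainsZero ∧ W.IsClosedUnderExtensions ∧
    W.IsClosedUnderKernels ∧ W.IsClosedUnderCokernels}

/-- `Filt P`: the objects `M` with a finite filtration `0 = M₀ ⊆ M₁ ⊆ ⋯ ⊆ Mₙ = M` whose
subquotients `Mᵢ₊₁ / Mᵢ` belong to `P`. -/
def filt (P : ObjectProperty C) : ObjectProperty C := fun M =>
  ∃ (n : ℕ) (F : ℕ → Subobject M) (hF : Monotone F), F 0 = ⊥ ∧ F n = ⊤ ∧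
    ∀ i < n, P (cokernel ((F i).ofLE (F (i + 1)) (hF i.le_succ)))

/-- `simp W`: the objects of `W` that are simple objects of the category `W`. -/
def simpleObjects (W : ObjectProperty C) : ObjectProperty C := fun X =>
  ∃ h : W X, Simple (⟨X, h⟩ : W.FullSubcategory)

/-- The set of (isomorphism classes of) bricks corresponding to `CJR(T)` under the correspondence
`B ↔ T(B)` between bricks and completely join-irreducible torsion classes. -/
def cjrBricks (T : Tors C) : ObjectProperty C := fun B =>
  IsBrick B ∧ torsClosure (isoClass B) ∈ CJR T

/-- The set of (isomorphism classes of) bricks corresponding to `CMR(T)` under the correspondence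
`B ↔ ⊥B` between bricks and completely meet-irreducible torsion classes. -/
def cmrBricks (T : Tors C) : ObjectProperty C := fun B =>
  IsBrick B ∧ leftPerp (isoClass B) ∈ CMR T

end Category

end TorsKappa

open TorsKappa

/-!
For a brick `B`, the torsion class `T(B)` has a greatest proper torsion subclass, namely
`T(B) ∩ ⊥B`: a map from an object of `T(B)` to `B` is zero or an epimorphism. In a length category
every completely join-irreducible torsion class is of the form `T(B)` and every completely
meet-irreducible one of the form `⊥B`, because a strict inclusion `U < T` of torsion classes is
witnessed by a brick in `T` which is torsion-free for `U`. Proper quotients of `B` lie in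
`T(B) ∩ ⊥B`, so `κ(T(B)) = ⊥B`. For a semibrick `S`, the join of the `T(B)` and the meet of the
`⊥B` with `B ∈ S` are canonical representations of `T(S)` and `⊥S`; conversely, the bricks of a
canonical representation form a semibrick, because a nonzero map between two nonisomorphic ones
would allow one of the members to be replaced by a smaller (larger) class. Hence the extended kappa
map sends `T(S)` to `⊥S` for every semibrick `S`. The wide subcategories enter through `Filt`, since
Schur's lemma makes the semibricks the sets of simple objects of wide subcategories, and `T` and
`⊥(-)` do not change under passing to filtered objects.
-/

namespace TorsKappa

/-! ### Canonical representations in a complete lattice -/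

section CompleteLattice

variable {L : Type*} [CompleteLattice L] {x a y : L} {A : Set L}

theorem IsCompletelyJoinIrreducible.lowerStar_lt {j : L} (hj : IsCompletelyJoinIrreducible j) :
    lowerStar j < j :=
  lt_of_le_of_ne (sSup_le fun _ h => h.le) fun h => lt_irrefl j (hj {x | x < j} h.symm)

theorem IsCanonicalJoinRep.le_of_le_sup_sSup_diff (hA : IsCanonicalJoinRep x A) (ha : a ∈ A)
    (hya : y ≤ a) (h : a ≤ y ⊔ sSup (A \ {a})) : a ≤ y := by
  have hx : x = sSup (insert y (A \ {a})) := by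
    rw [hA.eq_sSup, sSup_insert]
    refine le_antisymm (sSup_le fun b hb => ?_)
      (sup_le (hya.trans (le_sSup ha)) (sSup_le_sSup Set.sdiff_subset))
    obtain rfl | hba := eq_or_ne b a
    · exact h
    · exact le_sup_of_le_right (le_sSup ⟨hb, hba⟩)
  obtain ⟨b, rfl | hb, hab⟩ := hA.refines _ hx a ha
  · exact hab
  · exact absurd (hA.antichain a ha b hb.1 hab).symm hb.2

theorem IsCanonicalMeetRep.dual (hA : IsCanonicalMeetRep x A) :
    IsCanonicalJoinRep (OrderDual.toDual x) (OrderDual.ofDual ⁻¹' A) where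
  eq_sSup := hA.eq_sInf
  refines := hA.refines
  antichain a₁ h₁ a₂ h₂ h := (hA.antichain a₂ h₂ a₁ h₁ h).symm

theorem IsCanonicalMeetRep.le_of_inf_sInf_diff_le (hA : IsCanonicalMeetRep x A) (ha : a ∈ A)
    (hay : a ≤ y) (h : y ⊓ sInf (A \ {a}) ≤ a) : y ≤ a :=
  hA.dual.le_of_le_sup_sSup_diff ha hay h

end CompleteLattice

/-! ### Composition series and chain conditions -/

section ModularLattice

variable {L : Type*} [Lattice L] [IsModularLattice L] {a b : L}

theorem strictMono_Iic_prod (h : a ≤ b) : StrictMono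
    (fun y : Set.Iic b => ((⟨y.1 ⊓ a, inf_le_right⟩, ⟨y.1 ⊔ a, le_sup_right, sup_le y.2 h⟩) :
      Set.Iic a × Set.Icc a b)) :=
  fun _ _ hxy => strictMono_inf_prod_sup (z := a) (Subtype.coe_lt_coe.2 hxy)

theorem wellFounded_Iic_of_covBy (h : a ⋖ b)
    (ha : WellFoundedLT (Set.Iic a) ∧ WellFoundedGT (Set.Iic a)) :
    WellFoundedLT (Set.Iic b) ∧ WellFoundedGT (Set.Iic b) := by
  obtain ⟨_, _⟩ := ha
  have : Finite (Set.Icc a b) := by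
    rw [h.Icc_eq]
    exact Set.toFinite _
  exact ⟨(strictMono_Iic_prod h.le).wellFoundedLT, (strictMono_Iic_prod h.le).wellFoundedGT⟩

theorem wellFounded_of_covBy_series [BoundedOrder L] (s : RelSeries {p : L × L | p.1 ⋖ p.2})
    (h₀ : s.head = ⊥) (h₁ : s.last = ⊤) : WellFoundedLT L ∧ WellFoundedGT L := by
  have key : ∀ i, WellFoundedLT (Set.Iic (s i)) ∧ WellFoundedGT (Set.Iic (s i)) := by
    intro i
    induction i using Fin.induction with
    | zero =>
      rw [show s 0 = ⊥ from h₀, Set.Iic_bot]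
      exact ⟨inferInstance, inferInstance⟩
    | succ i ih => exact wellFounded_Iic_of_covBy (s.step i) ih
  have htop := key (Fin.last _)
  rw [show s (Fin.last _) = ⊤ from h₁] at htop
  obtain ⟨_, _⟩ := htop
  have hm : StrictMono (fun x : L => (⟨x, le_top⟩ : Set.Iic (⊤ : L))) := fun _ _ h => h
  exact ⟨hm.wellFoundedLT, hm.wellFoundedGT⟩

end ModularLattice

section Subobjects

variable {C : Type u} [Category.{v} C] [Abelian C] {X A : C} {P Q : Subobject X}

theorem le_of_epi_refinement (π : A ⟶ (P : C)) [Epi π] (h : Q.Factors (π ≫ P.arrow)) :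
    P ≤ Q := by
  have := strongEpi_of_epi π
  have sq : CommSq (Q.factorThru _ h) π Q.arrow P.arrow := ⟨by simp⟩
  exact Subobject.le_of_comm sq.lift sq.fac_right

theorem exists_refinement_of_factors_sup {f : A ⟶ X} (h : (P ⊔ Q).Factors f) :
    ∃ (A' : C) (π : A' ⟶ A) (_ : Epi π) (p : A' ⟶ (P : C)) (q : A' ⟶ (Q : C)),
      π ≫ f = p ≫ P.arrow + q ≫ Q.arrow := by
  let φ := biprod.desc P.arrow Q.arrow
  have hle : P ⊔ Q ≤ Subobject.mk (image.ι φ) :=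
    sup_le (Subobject.le_mk_of_comm (biprod.inl ≫ factorThruImage φ) (by simp [φ]))
      (Subobject.le_mk_of_comm (biprod.inr ≫ factorThruImage φ) (by simp [φ]))
  obtain ⟨g, hg⟩ : ∃ g : A ⟶ image φ, g ≫ image.ι φ = f :=
    (Subobject.mk_factors_iff _ _).1 (Subobject.factors_of_le f hle h)
  obtain ⟨A', π, hπ, x, hx⟩ := surjective_up_to_refinements_of_epi (factorThruImage φ) g
  refine ⟨A', π, hπ, x ≫ biprod.fst, x ≫ biprod.snd, ?_⟩
  calc π ≫ f = x ≫ φ := by rw [← hg, reassoc_of% hx, image.fac]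
    _ = _ := by simp only [φ, biprod.desc_eq, Preadditive.comp_add, Category.assoc]

-- An element `p + q` of `(P ⊔ Q) ⊓ R` with `P ≤ R` has `q ∈ Q ⊓ R`; elements exist only after
-- passing to an epimorphic cover.
instance (X : C) : IsModularLattice (Subobject X) where
  sup_inf_le_assoc_of_le {P} Q R hPR := by
    obtain ⟨A, π, _, p, q, h⟩ := exists_refinement_of_factors_sup (Subobject.factors_of_le
      ((P ⊔ Q) ⊓ R).arrow (inf_le_left (b := R)) (Subobject.factors_self _))
    have hp : R.Factors (p ≫ P.arrow) :=
      Subobject.factors_of_le _ hPR (Subobject.factors_comp_arrow _)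
    have hpq : R.Factors (π ≫ ((P ⊔ Q) ⊓ R).arrow) :=
      Subobject.factors_of_factors_right _
        (Subobject.factors_of_le _ (inf_le_right (a := P ⊔ Q)) (Subobject.factors_self _))
    have hq : R.Factors (q ≫ Q.arrow) := Subobject.factors_right_of_factors_add _ _ (h ▸ hpq) hp
    refine le_of_epi_refinement π ?_
    rw [h]
    exact Subobject.factors_add _ _
      (Subobject.factors_of_le _ le_sup_left (Subobject.factors_comp_arrow _))
      (Subobject.factors_of_le _ le_sup_right
        ((Subobject.inf_factors _).2 ⟨Subobject.factors_comp_arrow _, hq⟩))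

theorem IsLengthCategory.isArtinianObject (hC : IsLengthCategory C) (X : C) :
    IsArtinianObject X :=
  let ⟨s, h₀, h₁⟩ := hC X
  ⟨(wellFounded_of_covBy_series s h₀ h₁).1⟩

theorem IsLengthCategory.isNoetherianObject (hC : IsLengthCategory C) (X : C) :
    IsNoetherianObject X :=
  let ⟨s, h₀, h₁⟩ := hC X
  ⟨(wellFounded_of_covBy_series s h₀ h₁).2⟩

-- Fitting's argument: the kernels of the powers of `f` stabilise.
theorem isIso_of_epi_endo [IsNoetherianObject X] (f : End X) [Epi f] : IsIso f := by
  have hepi (n : ℕ) : Epi (f ^ n) := by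
    induction n with
    | zero => exact inferInstanceAs (Epi (𝟙 X))
    | succ n ih => exact pow_succ f n ▸ epi_comp f (f ^ n)
  let K : ℕ →o Subobject X := ⟨fun n => kernelSubobject (f ^ n), monotone_nat_of_le_succ fun n =>
    pow_succ' f n ▸ kernelSubobject_comp_le (f ^ n) f⟩
  obtain ⟨n, hn⟩ := monotone_chain_condition_of_isNoetherianObject K
  have : Mono f := Preadditive.mono_of_cancel_zero f fun {A} a ha => by
    obtain ⟨A', π, _, b, hb⟩ := surjective_up_to_refinements_of_epi (f ^ n) a
    have hb' : (K (n + 1)).Factors b := (kernelSubobject_factors_iff _ _).2 <| by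
      rw [pow_succ', End.mul_def, ← Category.assoc, ← hb, Category.assoc, ha, comp_zero]
    rw [← hn (n + 1) n.le_succ] at hb'
    rw [← cancel_epi π, hb, (kernelSubobject_factors_iff _ _).1 hb', comp_zero]
  exact isIso_of_mono_of_epi f

end Subobjects

/-! ### Short exact sequences -/

section ShortExact

variable {C : Type u} [Category.{v} C] [Abelian C]

theorem shortExact_cokernel {X Y : C} (f : X ⟶ Y) [Mono f] :
    (ShortComplex.mk f (cokernel.π f) (cokernel.condition f)).ShortExact :=
  .mk' (ShortComplex.exact_cokernel f) ‹_› (inferInstanceAs (Epi (cokernel.π f)))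

/-- In a short exact sequence the last term is the cokernel of the first map; this transports
membership in subcategories between the two. -/
noncomputable def cokernelIsoX₃ {S : ShortComplex C} (hS : S.ShortExact) : cokernel S.f ≅ S.X₃ :=
  IsColimit.coconePointUniqueUpToIso (cokernelIsCokernel _) hS.gIsCokernel

/-- In a short exact sequence the first term is the kernel of the last map; this transports
membership in subcategories between the two. -/
noncomputable def kernelIsoX₁ {S : ShortComplex C} (hS : S.ShortExact) : kernel S.g ≅ S.X₁ :=
  IsLimit.conePointUniqueUpToIso (kernelIsKernel _) hS.fIsKernel

theorem shortExact_pullback {S : ShortComplex C} (hS : S.ShortExact) {Y : C} (f : Y ⟶ S.X₃) :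
    (ShortComplex.mk (pullback.lift S.f 0 (by simp)) (pullback.snd S.g f)
      (pullback.lift_snd _ _ _)).ShortExact := by
  have := hS.mono_f
  have := hS.epi_g
  have hmono : Mono (pullback.lift S.f 0 (by simp) : S.X₁ ⟶ pullback S.g f) :=
    mono_of_mono_fac (pullback.lift_fst _ _ _)
  refine .mk' (ShortComplex.exact_of_f_is_kernel _ (KernelFork.IsLimit.ofι' _ _ fun k hk => ?_))
    hmono (inferInstanceAs (Epi (pullback.snd S.g f)))
  have hk' : (k ≫ pullback.fst S.g f) ≫ S.g = 0 := by
    rw [Category.assoc, pullback.condition, reassoc_of% hk, zero_comp]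
  refine ⟨hS.exact.lift _ hk', pullback.hom_ext ?_ ?_⟩
  · rw [Category.assoc, pullback.lift_fst, hS.exact.lift_f]
  · rw [Category.assoc, pullback.lift_snd, comp_zero]
    exact hk.symm

theorem shortExact_pullback_fst {S : ShortComplex C} (hS : S.ShortExact) {E : C} (p : E ⟶ S.X₂)
    [Epi p] : (ShortComplex.mk (pullback.fst p S.f) (p ≫ S.g)
      (by rw [pullback.condition_assoc, S.zero, comp_zero])).ShortExact := by
  have := hS.mono_f
  have := hS.epi_g
  exact .mk' (ShortComplex.exact_of_f_is_kernel _ (KernelFork.IsLimit.ofι' _ _ fun k hk =>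
      ⟨pullback.lift k (hS.exact.lift (k ≫ p) (by simpa using hk)) (by simp),
        pullback.lift_fst _ _ _⟩))
    (inferInstanceAs (Mono (pullback.fst p S.f))) (epi_comp p S.g)

variable {X Y Z : C} (f : X ⟶ Y) (g : Y ⟶ Z)

theorem shortExact_kernel_comp [Mono f] [Epi (f ≫ g)] : ∃ (i : kernel (f ≫ g) ⟶ kernel g)
    (p : kernel g ⟶ cokernel f) (w : i ≫ p = 0), (ShortComplex.mk i p w).ShortExact := by
  have hseq := kernelCokernelCompSequence_exact f g
  have hfac : kernel.map (f ≫ g) g f (𝟙 Z) (by simp) ≫ kernel.ι g = kernel.ι (f ≫ g) ≫ f := by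
    simp
  exact ⟨_, _, _, .mk' (hseq.exact 1) (mono_of_mono_fac hfac)
    ((hseq.exact 2).epi_f ((isZero_cokernel_of_epi (f ≫ g)).eq_zero_of_tgt _))⟩

theorem shortExact_cokernel_comp [Mono g] : ∃ (i : cokernel f ⟶ cokernel (f ≫ g))
    (p : cokernel (f ≫ g) ⟶ cokernel g) (w : i ≫ p = 0), (ShortComplex.mk i p w).ShortExact := by
  have hseq := kernelCokernelCompSequence_exact f g
  have hepi : Epi ((kernelCokernelCompSequence f g).map' 4 5) := inferInstance
  exact ⟨_, _, _, .mk' (hseq.exact 3)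
    ((hseq.exact 2).mono_g ((isZero_kernel_of_mono g).eq_zero_of_src _)) hepi⟩

theorem exists_kernel_map_of_epi_comp [Epi (f ≫ g)] : ∃ t : kernel (f ≫ g) ⟶ kernel g,
    Nonempty (kernel t ≅ kernel f) ∧ Nonempty (cokernel t ≅ cokernel f) := by
  have hseq := kernelCokernelCompSequence_exact f g
  have : Mono ((kernelCokernelCompSequence f g).map' 0 1) := inferInstance
  have : Epi ((kernelCokernelCompSequence f g).map' 2 3) :=
    (hseq.exact 2).epi_f ((isZero_cokernel_of_epi (f ≫ g)).eq_zero_of_tgt _)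
  exact ⟨(kernelCokernelCompSequence f g).map' 1 2,
    ⟨IsLimit.conePointUniqueUpToIso (limit.isLimit _) (hseq.exact 0).fIsKernel⟩,
    ⟨IsColimit.coconePointUniqueUpToIso (colimit.isColimit _) (hseq.exact 1).gIsCokernel⟩⟩

end ShortExact

/-! ### Extremal subobjects with a given property -/

section Extremal

variable {C : Type u} [Category.{v} C] [Abelian C] (P : ObjectProperty C)
  [P.IsClosedUnderIsomorphisms]

theorem exists_subobject_no_subobject_cokernel [P.ContainsZero] [P.IsClosedUnderExtensions] (M : C)
    [IsNoetherianObject M] : ∃ Q : Subobject M, P (Q : C) ∧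
      ∀ {Y : C} (f : Y ⟶ cokernel Q.arrow) [Mono f], P Y → f = 0 := by
  obtain ⟨Q, hQ, hmax⟩ := (wellFounded_gt (α := Subobject M)).has_min {Q | P (Q : C)}
    ⟨⊥, P.prop_of_isZero ((isZero_zero C).of_iso Subobject.botCoeIsoZero)⟩
  refine ⟨Q, hQ, fun {Y} f _ hY => ?_⟩
  let π := cokernel.π Q.arrow
  have hR : P (pullback π f) :=
    P.prop_X₂_of_shortExact (shortExact_pullback (shortExact_cokernel Q.arrow) f) hQ hY
  have hQR : Q ≤ Subobject.mk (pullback.fst π f) :=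
    Subobject.le_mk_of_comm (pullback.lift Q.arrow 0 (by simp [π])) (pullback.lift_fst _ _ _)
  have hRQ : Subobject.mk (pullback.fst π f) ≤ Q := (hQR.eq_of_not_lt
    (hmax _ (P.prop_of_iso (Subobject.underlyingIso _).symm hR))).ge
  have hfst : pullback.fst π f ≫ π = 0 := by
    rw [← Subobject.ofMkLE_arrow hRQ, Category.assoc, cokernel.condition, comp_zero]
  exact zero_of_epi_comp (pullback.snd π f) (by rw [← pullback.condition, hfst])

theorem exists_nonzero_subobject_isIso_of_mono {N : C} [IsArtinianObject N] (hN : P N)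
    (h0 : ¬ IsZero N) : ∃ I : Subobject N, P (I : C) ∧ ¬ IsZero (I : C) ∧
      ∀ {Z : C} (g : Z ⟶ (I : C)) [Mono g], P Z → ¬ IsZero Z → IsIso g := by
  obtain ⟨I, ⟨hI, hI0⟩, hmin⟩ := (wellFounded_lt (α := Subobject N)).has_min
    {I | P (I : C) ∧ ¬ IsZero (I : C)}
    ⟨⊤, P.prop_of_iso (asIso (⊤ : Subobject N).arrow).symm hN,
      fun h => h0 (h.of_iso (asIso (⊤ : Subobject N).arrow).symm)⟩
  refine ⟨I, hI, hI0, fun {Z} g _ hZ hZ0 => ?_⟩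
  have hle : Subobject.mk (g ≫ I.arrow) ≤ I := Subobject.mk_le_of_comm g rfl
  have hge : I ≤ Subobject.mk (g ≫ I.arrow) := (hle.eq_of_not_lt
    (hmin _ ⟨P.prop_of_iso (Subobject.underlyingIso _).symm hZ,
      fun h => hZ0 (h.of_iso (Subobject.underlyingIso _).symm)⟩)).ge
  have hsec : Subobject.ofLEMk I (g ≫ I.arrow) hge ≫ g = 𝟙 _ := by
    rw [← cancel_mono I.arrow]
    simp
  have : Epi g := epi_of_epi_fac hsec
  exact isIso_of_mono_of_epi g

end Extremal

/-! ### Filtrations -/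

section Filtrations

variable {C : Type u} [Category.{v} C] [Abelian C] {P : ObjectProperty C}

/-- The inductive form of `filt P`, whose induction principle peels off the top subquotient: the
objects obtained from a zero object by finitely many extensions by objects of `P`. -/
inductive FiltBy (P : ObjectProperty C) : C → Prop
  | zero {M : C} (h : IsZero M) : FiltBy P M
  | step {S : ShortComplex C} (hS : S.ShortExact) (h₁ : FiltBy P S.X₁) (h₃ : P S.X₃) :
      FiltBy P S.X₂

namespace FiltBy

theorem of_iso {M N : C} (h : FiltBy P M) (e : M ≅ N) : FiltBy P N := by
  cases h with
  | zero h => exact zero (h.of_iso e.symm)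
  | @step S hS h₁ h₃ =>
    let i : S ≅ .mk (S.f ≫ e.hom) (e.inv ≫ S.g) (by simp) :=
      ShortComplex.isoMk (Iso.refl _) e (Iso.refl _) (by simp) (by simp)
    exact step (ShortComplex.shortExact_of_iso i hS) h₁ h₃

theorem of_prop {M : C} (h : P M) : FiltBy P M :=
  step (S := .mk (0 : 0 ⟶ M) (𝟙 M) zero_comp)
    (ShortComplex.Splitting.ofIsZeroOfIsIso _ (isZero_zero C)
      (inferInstanceAs (IsIso (𝟙 M)))).shortExact (zero (isZero_zero C)) h

theorem ext {A E M : C} {i : A ⟶ E} {p : E ⟶ M} {w : i ≫ p = 0}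
    (h : (ShortComplex.mk i p w).ShortExact) (hA : FiltBy P A) (hM : FiltBy P M) :
    FiltBy P E := by
  induction hM generalizing A E with
  | zero hM =>
    have : IsIso i := h.isIso_f_iff.2 hM
    exact hA.of_iso (asIso i)
  | @step S hS _ h₃ ih =>
    have : Epi p := h.epi_g
    exact step (shortExact_pullback_fst hS p) (ih (shortExact_pullback h S.f) hA) h₃

instance : ObjectProperty.IsClosedUnderIsomorphisms (FiltBy P) where
  of_iso e h := h.of_iso e

instance : ObjectProperty.ContainsZero (FiltBy P) where
  exists_zero := ⟨0, isZero_zero C, .zero (isZero_zero C)⟩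

instance : ObjectProperty.IsClosedUnderExtensions (FiltBy P) where
  prop_X₂_of_shortExact hS h₁ h₃ := .ext hS h₁ h₃

theorem le_of_le {Q : ObjectProperty C} [Q.IsClosedUnderIsomorphisms] [Q.ContainsZero]
    [Q.IsClosedUnderExtensions] (h : P ≤ Q) : FiltBy P ≤ Q := by
  intro M hM
  induction hM with
  | zero h => exact Q.prop_of_isZero h
  | step hS _ h₃ ih => exact Q.prop_X₂_of_shortExact hS ih (h _ h₃)

theorem of_filt {M : C} (hM : filt P M) : FiltBy P M := by
  obtain ⟨n, F, hF, h₀, hn, h⟩ := hM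
  have key : ∀ i ≤ n, FiltBy P (F i : C) := by
    intro i hi
    induction i with
    | zero => exact h₀ ▸ .zero ((isZero_zero C).of_iso Subobject.botCoeIsoZero)
    | succ i ih => exact .step (shortExact_cokernel _) (ih (by lia)) (h i (by lia))
  have htop : FiltBy P ((⊤ : Subobject M) : C) := hn ▸ key n le_rfl
  exact htop.of_iso (asIso (⊤ : Subobject M).arrow)

end FiltBy

theorem prop_cokernel_ofLE [P.IsClosedUnderIsomorphisms] {X Y M : C} {α : X ⟶ M} {β : Y ⟶ M}
    [Mono α] [Mono β] {A B : Subobject M} (hA : A = Subobject.mk α) (hB : B = Subobject.mk β)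
    {u : X ⟶ Y} (hu : u ≫ β = α) (hAB : A ≤ B) (h : P (cokernel u)) :
    P (cokernel (A.ofLE B hAB)) := by
  subst hA hB
  refine P.prop_of_iso (cokernel.mapIso _ _ (Subobject.underlyingIso α).symm
    (Subobject.underlyingIso β).symm ?_) h
  rw [← cancel_mono (Subobject.mk β).arrow]
  simp [hu]

theorem filt_X₂_of_shortExact [P.IsClosedUnderIsomorphisms] {S : ShortComplex C}
    (hS : S.ShortExact) (h₁ : filt P S.X₁) (h₃ : P S.X₃) : filt P S.X₂ := by
  obtain ⟨n, F, hF, h₀, hn, hq⟩ := h₁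
  have := hS.mono_f
  let G : ℕ → Subobject S.X₂ := fun i => if i ≤ n then (Subobject.map S.f).obj (F i) else ⊤
  have hG : Monotone G := by
    intro i j hij
    by_cases hj : j ≤ n
    · simp only [G, hj, hij.trans hj, if_true]
      exact (Subobject.map S.f).monotone (hF hij)
    · simp [G, hj]
  have hmap (j : ℕ) : (Subobject.map S.f).obj (F j) = Subobject.mk ((F j).arrow ≫ S.f) := by
    rw [← Subobject.map_mk, Subobject.mk_arrow]
  refine ⟨n + 1, G, hG, by simp [G, h₀, Subobject.map_bot], by simp [G], fun i hi => ?_⟩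
  obtain hi | rfl := (Nat.lt_succ_iff.1 hi).lt_or_eq
  · exact prop_cokernel_ofLE (α := (F i).arrow ≫ S.f) (β := (F (i + 1)).arrow ≫ S.f)
      (by simp [G, hi.le, hmap]) (by simp [G, Nat.succ_le_of_lt hi, hmap])
      (u := (F i).ofLE (F (i + 1)) (hF i.le_succ)) (by simp) _ (hq i hi)
  · exact prop_cokernel_ofLE (α := S.f) (β := 𝟙 S.X₂) (by simp [G, hn, Subobject.map_top])
      (by simp [G, Subobject.top_eq_id]) (u := S.f) (by simp) _
      (P.prop_of_iso (cokernelIsoX₃ hS).symm h₃)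

theorem filt_eq_filtBy [P.IsClosedUnderIsomorphisms] : filt P = FiltBy P := by
  ext M
  refine ⟨.of_filt, fun hM => ?_⟩
  induction hM with
  | @zero M hM =>
    have := Subobject.subsingleton_of_isZero hM
    exact ⟨0, fun _ => ⊥, monotone_const, rfl, Subsingleton.elim _ _, by simp⟩
  | step hS _ h₃ ih => exact filt_X₂_of_shortExact hS ih h₃

end Filtrations

/-! ### Torsion classes -/

theorem isoClass_congr {C : Type u} [Category.{v} C] {B B' : C} (e : B ≅ B') :
    isoClass B = isoClass B' := by
  ext X
  exact ⟨fun ⟨i⟩ => ⟨i ≪≫ e⟩, fun ⟨i⟩ => ⟨i ≪≫ e.symm⟩⟩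

section TorsionClasses

variable {C : Type u} [Category.{v} C] [Abelian C]

theorem isZero_image_iff {X Y : C} (f : X ⟶ Y) : IsZero (image f) ↔ f = 0 := by
  constructor
  · intro h
    rw [← image.fac f, h.eq_zero_of_src (image.ι f), comp_zero]
  · rintro rfl
    exact (isZero_zero C).of_iso imageZero

instance (T : Tors C) : T.1.ContainsZero := T.2.containsZero

instance (T : Tors C) : T.1.IsClosedUnderQuotients := T.2.quotients

instance (T : Tors C) : T.1.IsClosedUnderExtensions := T.2.extensions

variable {P Q : ObjectProperty C} {T : Tors C} {B M : C}

theorem Tors.image (T : Tors C) (f : M ⟶ B) (hM : T.1 M) : T.1 (image f) :=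
  T.1.prop_of_epi (factorThruImage f) hM

theorem Tors.inf_iff {U : Tors C} : (T ⊓ U).1 M ↔ T.1 M ∧ U.1 M := by
  refine ⟨fun h => ⟨inf_le_left (b := U) M h, inf_le_right (a := T) M h⟩, fun h => ?_⟩
  rw [← sInf_pair]
  rintro V (rfl | rfl)
  exacts [h.1, h.2]

theorem torsClosure_le_iff : torsClosure P ≤ T ↔ P ≤ T.1 :=
  ⟨fun h M hM => h M fun _ hU => hU M hM, fun h => sInf_le (a := T) h⟩

theorem le_torsClosure (P : ObjectProperty C) : P ≤ (torsClosure P).1 :=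
  torsClosure_le_iff.1 le_rfl

theorem torsClosure_mono (h : P ≤ Q) : torsClosure P ≤ torsClosure Q :=
  torsClosure_le_iff.2 (h.trans (le_torsClosure Q))

theorem leftPerp_anti (h : P ≤ Q) : leftPerp Q ≤ leftPerp P :=
  fun _ hM _ f hY => hM f (h _ hY)

theorem torsClosure_isoClass_le_iff : torsClosure (isoClass B) ≤ T ↔ T.1 B :=
  torsClosure_le_iff.trans
    ⟨fun h => h B ⟨Iso.refl B⟩, fun h _ ⟨e⟩ => T.1.prop_of_iso e.symm h⟩

theorem torsClosure_isoClass_self (B : C) : (torsClosure (isoClass B)).1 B :=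
  torsClosure_isoClass_le_iff.1 le_rfl

theorem leftPerp_isoClass_iff : (leftPerp (isoClass B)).1 M ↔ ∀ f : M ⟶ B, f = 0 :=
  ⟨fun h f => h f ⟨Iso.refl B⟩, fun h _ f ⟨e⟩ => zero_of_comp_mono e.hom (h (f ≫ e.hom))⟩

theorem leftPerp_iff_forall :
    (leftPerp P).1 M ↔ ∀ B, P B → (leftPerp (isoClass B)).1 M :=
  ⟨fun h _ hB => leftPerp_isoClass_iff.2 fun f => h f hB,
    fun h B f hB => leftPerp_isoClass_iff.1 (h B hB) f⟩

theorem le_leftPerp_iff_forall : T ≤ leftPerp P ↔ ∀ B, P B → T ≤ leftPerp (isoClass B) :=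
  ⟨fun h B hB M hM => leftPerp_iff_forall.1 (h M hM) B hB,
    fun h M hM => leftPerp_iff_forall.2 fun B hB => h B hB M hM⟩

theorem leftPerp_eq_sInf (P : ObjectProperty C) :
    leftPerp P = sInf {T | ∃ B, P B ∧ T = leftPerp (isoClass B)} :=
  eq_of_forall_le_iff fun T => by
    rw [le_leftPerp_iff_forall, le_sInf_iff]
    exact ⟨fun h _ ⟨B, hB, hU⟩ => hU ▸ h B hB, fun h B hB => h _ ⟨B, hB, rfl⟩⟩

theorem torsClosure_eq_sSup (P : ObjectProperty C) :
    torsClosure P = sSup {T | ∃ B, P B ∧ T = torsClosure (isoClass B)} :=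
  eq_of_forall_ge_iff fun T => by
    rw [torsClosure_le_iff, sSup_le_iff]
    exact ⟨fun h _ ⟨B, hB, hU⟩ => hU ▸ torsClosure_isoClass_le_iff.2 (h B hB),
      fun h B hB => torsClosure_isoClass_le_iff.1 (h _ ⟨B, hB, rfl⟩)⟩

theorem rightOrthogonal_of_mono {N : C} (i : M ⟶ N) [Mono i] (h : P.rightOrthogonal N) :
    P.rightOrthogonal M :=
  fun _ f hX => zero_of_comp_mono i (h (f ≫ i) hX)

theorem rightOrthogonal_leftPerp_self (B : C) : (leftPerp (isoClass B)).1.rightOrthogonal B :=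
  fun _ f hX => leftPerp_isoClass_iff.1 hX f

theorem exists_ne_zero_of_torsClosure (hM : (torsClosure P).1 M) (h0 : ¬ IsZero M) :
    ∃ B, P B ∧ ∃ f : B ⟶ M, f ≠ 0 := by
  by_contra! h
  have hle : torsClosure P ≤ leftPerp (isoClass M) :=
    torsClosure_le_iff.2 fun B hB => leftPerp_isoClass_iff.2 (h B hB)
  exact h0 ((IsZero.iff_id_eq_zero M).2 (leftPerp_isoClass_iff.1 (hle M hM) _))

theorem exists_epi_rightOrthogonal [IsNoetherianObject M] (hM : ¬ T.1 M) :
    ∃ (N : C) (f : M ⟶ N), Epi f ∧ ¬ IsZero N ∧ T.1.rightOrthogonal N := by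
  obtain ⟨Q, hQ, hmax⟩ := exists_subobject_no_subobject_cokernel T.1 M
  refine ⟨cokernel Q.arrow, cokernel.π _, inferInstance, fun h => hM ?_, fun X f hX => ?_⟩
  · have : Epi Q.arrow := Preadditive.epi_of_isZero_cokernel _ h
    exact T.1.prop_of_epi Q.arrow hQ
  · rw [← image.fac f, hmax (image.ι f) (T.image f hX), comp_zero]

theorem mem_of_forall_rightOrthogonal [IsNoetherianObject M]
    (h : ∀ N, T.1.rightOrthogonal N → ∀ f : M ⟶ N, f = 0) : T.1 M := by
  by_contra hM
  obtain ⟨N, f, hf, hN, hT⟩ := exists_epi_rightOrthogonal hM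
  exact hN (IsZero.of_epi_eq_zero f (h N hT f))

-- The brick is a minimal nonzero subobject in `T` of a `U`-torsion-free object in `T`: each of its
-- nonzero endomorphisms has an image in `T`, hence is surjective.
theorem exists_brick_of_not_le [∀ X : C, IsNoetherianObject X] [∀ X : C, IsArtinianObject X]
    {U : Tors C} (h : ¬ T ≤ U) : ∃ B, IsBrick B ∧ T.1 B ∧ U.1.rightOrthogonal B := by
  obtain ⟨M, hMT, hMU⟩ : ∃ M, T.1 M ∧ ¬ U.1 M := by
    by_contra! h'
    exact h h'
  obtain ⟨N, p, _, hN0, hNU⟩ := exists_epi_rightOrthogonal hMU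
  obtain ⟨I, hI, hI0, hmin⟩ :=
    exists_nonzero_subobject_isIso_of_mono T.1 (T.1.prop_of_epi p hMT) hN0
  refine ⟨I, ⟨⟨𝟙 _, 0, fun h => hI0 ((IsZero.iff_id_eq_zero _).2 h)⟩, fun f hf => ?_⟩, hI,
    rightOrthogonal_of_mono I.arrow hNU⟩
  have := hmin (image.ι f) (T.image f hI) fun h => hf ((isZero_image_iff f).1 h)
  have : Epi f := by
    rw [← image.fac f]
    exact epi_comp _ _
  exact (isUnit_iff_isIso f).2 (isIso_of_epi_endo f)

end TorsionClasses

/-! ### Bricks and semibricks -/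

section Semibricks

variable {C : Type u} [Category.{v} C] [Abelian C]

namespace IsBrick

variable {B B' : C}

theorem isIso (hB : IsBrick B) {f : B ⟶ B} (hf : f ≠ 0) : IsIso f :=
  (isUnit_iff_isIso f).1 (hB.2 f hf)

theorem id_ne_zero (hB : IsBrick B) : 𝟙 B ≠ 0 :=
  have := hB.1
  one_ne_zero (α := End B)

theorem not_isZero (hB : IsBrick B) : ¬ IsZero B :=
  fun h => hB.id_ne_zero (h.eq_of_src _ _)

theorem of_iso (hB : IsBrick B) (e : B ≅ B') : IsBrick B' :=
  have := hB.1
  ⟨e.conj.symm.toEquiv.nontrivial, fun f hf => (isUnit_map_iff e.conj.symm f).1 <|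
    hB.2 _ fun h => hf (zero_of_comp_mono e.inv (zero_of_epi_comp e.hom h))⟩

theorem not_leftPerp (hB : IsBrick B) : ¬ (leftPerp (isoClass B)).1 B :=
  fun h => hB.id_ne_zero (leftPerp_isoClass_iff.1 h _)

theorem isIso_of_epi (hB : IsBrick B) {f : B ⟶ B'} {g : B' ⟶ B} [Epi f] [Epi g] : IsIso f := by
  have : IsIso (f ≫ g) := hB.isIso fun h => hB.not_isZero (IsZero.of_epi_eq_zero _ h)
  have : Mono f := mono_of_mono f g
  exact isIso_of_mono_of_epi f

theorem isIso_of_mono (hB : IsBrick B) {f : B' ⟶ B} {g : B ⟶ B'} [Mono f] [Mono g] : IsIso f := by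
  have : IsIso (g ≫ f) := hB.isIso fun h => hB.not_isZero (IsZero.of_mono_eq_zero _ h)
  have : Epi f := epi_of_epi g f
  exact isIso_of_mono_of_epi f

end IsBrick

variable {S : ObjectProperty C} {M N B : C}

theorem isIso_of_mem_sbrick (hS : S ∈ sbrick C) {B₁ B₂ : C} (h₁ : S B₁) (h₂ : S B₂)
    {f : B₁ ⟶ B₂} (hf : f ≠ 0) : IsIso f := by
  obtain ⟨e⟩ : Nonempty (B₁ ≅ B₂) := by
    by_contra h
    exact hf (hS.2.2 B₁ B₂ h₁ h₂ h f)
  have : IsIso (f ≫ e.inv) :=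
    (hS.2.1 B₁ h₁).isIso fun h => hf (zero_of_comp_mono e.inv h)
  exact IsIso.of_isIso_comp_right f e.inv

theorem isoClass_mem_sbrick (hB : IsBrick B) : isoClass B ∈ sbrick C :=
  ⟨⟨fun e ⟨e'⟩ => ⟨e.symm ≪≫ e'⟩⟩, fun _ ⟨e⟩ => hB.of_iso e.symm,
    fun _ _ ⟨e₁⟩ ⟨e₂⟩ h => absurd ⟨e₁ ≪≫ e₂.symm⟩ h⟩

theorem epi_of_torsClosure (hS : S ∈ sbrick C) (hM : (torsClosure S).1 M) (hB : S B)
    {f : M ⟶ B} (hf : f ≠ 0) : Epi f := by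
  obtain ⟨B', hB', g, hg⟩ := exists_ne_zero_of_torsClosure ((torsClosure S).image f hM)
    fun h => hf ((isZero_image_iff f).1 h)
  have : IsIso (g ≫ image.ι f) :=
    isIso_of_mem_sbrick hS hB' hB fun h => hg (zero_of_comp_mono _ h)
  have : Epi (image.ι f) := epi_of_epi g _
  rw [← image.fac f]
  exact epi_comp _ _

theorem mono_of_rightOrthogonal_leftPerp (hS : S ∈ sbrick C)
    (hN : (leftPerp S).1.rightOrthogonal N) (hB : S B) {f : B ⟶ N} (hf : f ≠ 0) : Mono f := by
  obtain ⟨B', g, hB', hg⟩ : ∃ B', ∃ g : image f ⟶ B', S B' ∧ g ≠ 0 := by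
    by_contra! h
    exact hf (by rw [← image.fac f, hN (image.ι f) fun B' g hB' => h B' g hB', comp_zero])
  have : IsIso (factorThruImage f ≫ g) :=
    isIso_of_mem_sbrick hS hB hB' fun h => hg (zero_of_epi_comp _ h)
  have : Mono (factorThruImage f) := mono_of_mono _ g
  rw [← image.fac f]
  exact mono_comp _ _

theorem le_leftPerp_of_le_torsClosure (hS : S ∈ sbrick C) (hB : S B) {T : Tors C}
    (hT : T ≤ torsClosure S) (h : ¬ T.1 B) : T ≤ leftPerp (isoClass B) := fun M hM =>
  leftPerp_isoClass_iff.2 fun f => by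
    by_contra hf
    have := epi_of_torsClosure hS (hT M hM) hB hf
    exact h (T.1.prop_of_epi f hM)

theorem mem_of_leftPerp_le [IsNoetherianObject B] (hS : S ∈ sbrick C) (hB : S B)
    {T : Tors C} (hT : leftPerp S ≤ T) (h : ¬ T ≤ leftPerp (isoClass B)) : T.1 B := by
  obtain ⟨M, hM, f, hf⟩ : ∃ M, T.1 M ∧ ∃ f : M ⟶ B, f ≠ 0 := by
    by_contra! h'
    exact h fun M hM => leftPerp_isoClass_iff.2 (h' M hM)
  refine mem_of_forall_rightOrthogonal fun N hN g => ?_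
  by_contra hg
  have := mono_of_rightOrthogonal_leftPerp hS (fun X k hX => hN k (hT X hX)) hB hg
  exact hf (zero_of_comp_mono g (hN (f ≫ g) hM))

theorem exists_epi_of_torsClosure_isoClass {B' : C} (hB' : IsBrick B')
    (h : torsClosure (isoClass B) = torsClosure (isoClass B')) : ∃ f : B ⟶ B', Epi f := by
  obtain ⟨A, ⟨e⟩, f, hf⟩ :=
    exists_ne_zero_of_torsClosure (h ▸ torsClosure_isoClass_self B') hB'.not_isZero
  exact ⟨e.inv ≫ f, epi_of_torsClosure (isoClass_mem_sbrick hB')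
    (h ▸ torsClosure_isoClass_self B) ⟨Iso.refl B'⟩ fun h => hf (zero_of_epi_comp _ h)⟩

theorem iso_of_torsClosure_isoClass_eq {B' : C} (hB : IsBrick B) (hB' : IsBrick B')
    (h : torsClosure (isoClass B) = torsClosure (isoClass B')) : Nonempty (B ≅ B') := by
  obtain ⟨f, _⟩ := exists_epi_of_torsClosure_isoClass hB' h
  obtain ⟨g, _⟩ := exists_epi_of_torsClosure_isoClass hB h.symm
  have := hB.isIso_of_epi (f := f) (g := g)
  exact ⟨asIso f⟩

theorem exists_mono_of_leftPerp_isoClass {B' : C} (hB : IsBrick B)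
    (h : leftPerp (isoClass B) = leftPerp (isoClass B')) : ∃ f : B ⟶ B', Mono f := by
  obtain ⟨f, hf⟩ : ∃ f : B ⟶ B', f ≠ 0 := by
    by_contra! h'
    exact hB.not_leftPerp (h ▸ leftPerp_isoClass_iff.2 h')
  exact ⟨f, mono_of_rightOrthogonal_leftPerp (isoClass_mem_sbrick hB)
    (h ▸ rightOrthogonal_leftPerp_self B') ⟨Iso.refl B⟩ hf⟩

theorem iso_of_leftPerp_isoClass_eq {B' : C} (hB : IsBrick B) (hB' : IsBrick B')
    (h : leftPerp (isoClass B) = leftPerp (isoClass B')) : Nonempty (B ≅ B') := by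
  obtain ⟨f, _⟩ := exists_mono_of_leftPerp_isoClass hB h
  obtain ⟨g, _⟩ := exists_mono_of_leftPerp_isoClass hB' h.symm
  have := hB'.isIso_of_mono (f := f) (g := g)
  exact ⟨asIso f⟩

end Semibricks

/-! ### The kappa map on torsion classes -/

section Kappa

variable {C : Type u} [Category.{v} C] [Abelian C] {B : C}

theorem lt_torsClosure_isoClass_iff (hB : IsBrick B) {T : Tors C} :
    T < torsClosure (isoClass B) ↔ T ≤ torsClosure (isoClass B) ⊓ leftPerp (isoClass B) := by
  constructor
  · intro h
    exact le_inf h.le (le_leftPerp_of_le_torsClosure (isoClass_mem_sbrick hB) ⟨Iso.refl B⟩ h.le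
      fun hT => h.not_ge (torsClosure_isoClass_le_iff.2 hT))
  · intro h
    exact lt_of_le_of_ne (h.trans inf_le_left) fun he => hB.not_leftPerp
      ((he ▸ h).trans inf_le_right B (torsClosure_isoClass_self B))

theorem lowerStar_torsClosure_isoClass (hB : IsBrick B) : lowerStar (torsClosure (isoClass B)) =
    torsClosure (isoClass B) ⊓ leftPerp (isoClass B) :=
  le_antisymm (sSup_le fun _ h => (lt_torsClosure_isoClass_iff hB).1 h)
    (le_sSup ((lt_torsClosure_isoClass_iff hB).2 le_rfl))

theorem lowerStar_torsClosure_isoClass_cokernel (hB : IsBrick B) {I : C} {i : I ⟶ B}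
    (hi : i ≠ 0) : (lowerStar (torsClosure (isoClass B))).1 (cokernel i) := by
  rw [lowerStar_torsClosure_isoClass hB, Tors.inf_iff]
  refine ⟨(torsClosure _).1.prop_of_epi (cokernel.π i) (torsClosure_isoClass_self B),
    leftPerp_isoClass_iff.2 fun f => zero_of_epi_comp (cokernel.π i) ?_⟩
  by_contra h
  have := hB.isIso h
  exact hi (zero_of_comp_mono (cokernel.π i ≫ f) (by rw [cokernel.condition_assoc, zero_comp]))

theorem image_ι_ne_zero {X Y : C} {f : X ⟶ Y} (hf : f ≠ 0) : image.ι f ≠ 0 :=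
  fun h => hf (by rw [← image.fac f, h, comp_zero])

-- If `M ∈ x` has a nonzero map to `B`, then `B` is an extension of the cokernel of that map, which
-- lies in `T(B)_* ≤ x`, by its image, so `B ∈ T(B) ⊓ x = T(B)_*`.
theorem isGreatest_leftPerp_isoClass (hB : IsBrick B) :
    IsGreatest {x : Tors C | torsClosure (isoClass B) ⊓ x = lowerStar (torsClosure (isoClass B))}
      (leftPerp (isoClass B)) := by
  refine ⟨(lowerStar_torsClosure_isoClass hB).symm, fun x hx M hM =>
    leftPerp_isoClass_iff.2 fun f => ?_⟩
  by_contra hf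
  have hle : lowerStar (torsClosure (isoClass B)) ≤ x := hx.ge.trans inf_le_right
  have hxB : x.1 B := x.1.prop_X₂_of_shortExact (shortExact_cokernel (image.ι f)) (x.image f hM)
    (hle _ (lowerStar_torsClosure_isoClass_cokernel hB (image_ι_ne_zero hf)))
  have hB' : (lowerStar (torsClosure (isoClass B))).1 B :=
    hx ▸ Tors.inf_iff.2 ⟨torsClosure_isoClass_self B, hxB⟩
  rw [lowerStar_torsClosure_isoClass hB] at hB'
  exact hB.not_leftPerp (Tors.inf_iff.1 hB').2

theorem kappa_torsClosure_isoClass (hB : IsBrick B) :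
    kappa (torsClosure (isoClass B)) = leftPerp (isoClass B) :=
  (isGreatest_leftPerp_isoClass hB).isLUB.sSup_eq

section Irreducibles

variable [∀ X : C, IsNoetherianObject X] [∀ X : C, IsArtinianObject X]

theorem exists_brick_of_joinIrreducible {j : Tors C} (hj : IsCompletelyJoinIrreducible j) :
    ∃ B, IsBrick B ∧ j = torsClosure (isoClass B) := by
  obtain ⟨B, hB, hjB, hBs⟩ := exists_brick_of_not_le hj.lowerStar_lt.not_ge
  refine ⟨B, hB, (eq_of_le_of_not_lt (torsClosure_isoClass_le_iff.2 hjB) fun h => ?_).symm⟩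
  have hle : torsClosure (isoClass B) ≤ lowerStar j := le_sSup h
  exact hB.id_ne_zero (hBs _ (hle B (torsClosure_isoClass_self B)))

theorem exists_brick_of_meetIrreducible {m : Tors C}
    (hm : IsCompletelyJoinIrreducible (OrderDual.toDual m)) :
    ∃ B, IsBrick B ∧ m = leftPerp (isoClass B) := by
  obtain ⟨B, hB, hmB, hBm⟩ := exists_brick_of_not_le (OrderDual.ofDual_lt_ofDual.2
    hm.lowerStar_lt).not_ge
  have hle : m ≤ leftPerp (isoClass B) := fun M hM => leftPerp_isoClass_iff.2 fun f => hBm f hM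
  refine ⟨B, hB, eq_of_le_of_not_lt hle fun h => hB.not_leftPerp ?_⟩
  have hge : OrderDual.ofDual (lowerStar (OrderDual.toDual m)) ≤ leftPerp (isoClass B) :=
    sInf_le (a := leftPerp (isoClass B)) h
  exact hge B hmB

theorem isGreatest_kappa {j : Tors C} (hj : IsCompletelyJoinIrreducible j) :
    IsGreatest {x | j ⊓ x = lowerStar j} (kappa j) := by
  obtain ⟨B, hB, rfl⟩ := exists_brick_of_joinIrreducible hj
  exact kappa_torsClosure_isoClass hB ▸ isGreatest_leftPerp_isoClass hB

end Irreducibles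

end Kappa

/-! ### Canonical representations of torsion classes -/

section CanonicalRepresentations

variable {C : Type u} [Category.{v} C] [Abelian C] {S : ObjectProperty C}

theorem isCanonicalJoinRep_torsClosure (hS : S ∈ sbrick C) : IsCanonicalJoinRep (torsClosure S)
    {T | ∃ B, S B ∧ T = torsClosure (isoClass B)} where
  eq_sSup := torsClosure_eq_sSup S
  refines := by
    rintro X hX _ ⟨B, hB, rfl⟩
    by_contra! h
    have hle : torsClosure S ≤ leftPerp (isoClass B) := hX.trans_le <| sSup_le fun T hT =>
      le_leftPerp_of_le_torsClosure hS hB (hX ▸ le_sSup hT) fun hTB =>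
        h T hT (torsClosure_isoClass_le_iff.2 hTB)
    exact (hS.2.1 B hB).not_leftPerp (hle B (le_torsClosure S B hB))
  antichain := by
    rintro _ ⟨B₁, hB₁, rfl⟩ _ ⟨B₂, hB₂, rfl⟩ h
    obtain ⟨B, ⟨e⟩, f, hf⟩ := exists_ne_zero_of_torsClosure
      (torsClosure_isoClass_le_iff.1 h) (hS.2.1 B₁ hB₁).not_isZero
    have : IsIso f := isIso_of_mem_sbrick hS (hS.1.of_iso e.symm hB₂) hB₁ hf
    rw [isoClass_congr ((asIso f).symm ≪≫ e)]

theorem isCanonicalMeetRep_leftPerp [∀ X : C, IsNoetherianObject X] (hS : S ∈ sbrick C) :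
    IsCanonicalMeetRep (leftPerp S) {T | ∃ B, S B ∧ T = leftPerp (isoClass B)} where
  eq_sInf := leftPerp_eq_sInf S
  refines := by
    rintro X hX _ ⟨B, hB, rfl⟩
    by_contra! h
    have hle : torsClosure (isoClass B) ≤ leftPerp S := hX ▸ le_sInf fun T hT =>
      torsClosure_isoClass_le_iff.2 (mem_of_leftPerp_le hS hB (hX ▸ sInf_le hT) (h T hT))
    exact (hS.2.1 B hB).not_leftPerp
      (leftPerp_iff_forall.1 (torsClosure_isoClass_le_iff.1 hle) B hB)
  antichain := by
    rintro _ ⟨B₁, hB₁, rfl⟩ _ ⟨B₂, hB₂, rfl⟩ h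
    obtain ⟨f, hf⟩ : ∃ f : B₂ ⟶ B₁, f ≠ 0 := by
      by_contra! h'
      exact (hS.2.1 B₂ hB₂).not_leftPerp (h B₂ (leftPerp_isoClass_iff.2 h'))
    have : IsIso f := isIso_of_mem_sbrick hS hB₂ hB₁ hf
    rw [isoClass_congr (asIso f)]

theorem cjrBricks_torsClosure (hS : S ∈ sbrick C) : cjrBricks (torsClosure S) = S := by
  ext B
  rw [cjrBricks, (isCanonicalJoinRep_torsClosure hS).cjr_eq]
  constructor
  · rintro ⟨hB, B', hB', h⟩
    obtain ⟨e⟩ := iso_of_torsClosure_isoClass_eq hB (hS.2.1 B' hB') h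
    exact hS.1.of_iso e.symm hB'
  · exact fun hB => ⟨hS.2.1 B hB, B, hB, rfl⟩

theorem cmrBricks_leftPerp [∀ X : C, IsNoetherianObject X] (hS : S ∈ sbrick C) :
    cmrBricks (leftPerp S) = S := by
  ext B
  rw [cmrBricks, (isCanonicalMeetRep_leftPerp hS).cmr_eq]
  constructor
  · rintro ⟨hB, B', hB', h⟩
    obtain ⟨e⟩ := iso_of_leftPerp_isoClass_eq hB (hS.2.1 B' hB') h
    exact hS.1.of_iso e.symm hB'
  · exact fun hB => ⟨hS.2.1 B hB, B, hB, rfl⟩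

theorem extKappa_torsClosure (hS : S ∈ sbrick C) : extKappa (torsClosure S) = leftPerp S := by
  rw [extKappa, (isCanonicalJoinRep_torsClosure hS).cjr_eq, leftPerp_eq_sInf]
  congr 1
  ext T
  constructor
  · rintro ⟨_, ⟨B, hB, rfl⟩, rfl⟩
    exact ⟨B, hB, kappa_torsClosure_isoClass (hS.2.1 B hB)⟩
  · rintro ⟨B, hB, rfl⟩
    exact ⟨_, ⟨B, hB, rfl⟩, kappa_torsClosure_isoClass (hS.2.1 B hB)⟩

section FiniteLength

variable [∀ X : C, IsNoetherianObject X] [∀ X : C, IsArtinianObject X] {T : Tors C}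

theorem torsClosure_cjrBricks (hT : T ∈ lowerZero (Tors C)) : torsClosure (cjrBricks T) = T := by
  obtain ⟨A, hA⟩ := hT
  have hset : {U | ∃ B, cjrBricks T B ∧ U = torsClosure (isoClass B)} = A := by
    ext a
    simp only [cjrBricks, hA.cjr_eq, Set.mem_ofPred_eq]
    refine ⟨fun ⟨_, ⟨_, hB⟩, h⟩ => h ▸ hB, fun ha => ?_⟩
    obtain ⟨B, hB, rfl⟩ := exists_brick_of_joinIrreducible (hA.irreducible ha)
    exact ⟨B, ⟨hB, ha⟩, rfl⟩
  rw [torsClosure_eq_sSup, hset, ← hA.eq_sSup]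

theorem leftPerp_cmrBricks (hT : T ∈ upperZero (Tors C)) : leftPerp (cmrBricks T) = T := by
  obtain ⟨A, hA⟩ := hT
  have hset : {U | ∃ B, cmrBricks T B ∧ U = leftPerp (isoClass B)} = A := by
    ext a
    simp only [cmrBricks, hA.cmr_eq, Set.mem_ofPred_eq]
    refine ⟨fun ⟨_, ⟨_, hB⟩, h⟩ => h ▸ hB, fun ha => ?_⟩
    obtain ⟨B, hB, rfl⟩ := exists_brick_of_meetIrreducible (hA.dual.irreducible ha)
    exact ⟨B, ⟨hB, ha⟩, rfl⟩
  rw [leftPerp_eq_sInf, hset, ← hA.eq_sInf]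

end FiniteLength

section NonzeroMaps

variable {B₁ B₂ : C}

theorem torsClosure_isoClass_le_lowerStar_sup (hB₂ : IsBrick B₂) {f : B₁ ⟶ B₂} (hf : f ≠ 0) :
    torsClosure (isoClass B₂) ≤
      lowerStar (torsClosure (isoClass B₂)) ⊔ torsClosure (isoClass B₁) := by
  set U := lowerStar (torsClosure (isoClass B₂)) ⊔ torsClosure (isoClass B₁)
  have h₁ : U.1 B₁ := torsClosure_isoClass_le_iff.1 le_sup_right
  have hstar : lowerStar (torsClosure (isoClass B₂)) ≤ U := le_sup_left
  exact torsClosure_isoClass_le_iff.2 <| U.1.prop_X₂_of_shortExact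
    (shortExact_cokernel (image.ι f)) (U.image f h₁)
    (hstar _ (lowerStar_torsClosure_isoClass_cokernel hB₂ (image_ι_ne_zero hf)))

theorem leftPerp_isoClass_le_of_mono (i : B₁ ⟶ B₂) [Mono i] :
    leftPerp (isoClass B₂) ≤ leftPerp (isoClass B₁) := fun _ hM =>
  leftPerp_isoClass_iff.2 fun g => zero_of_comp_mono i (leftPerp_isoClass_iff.1 hM (g ≫ i))

theorem leftPerp_kernel_inf_le (f : B₁ ⟶ B₂) :
    leftPerp (isoClass (kernel f)) ⊓ leftPerp (isoClass B₂) ≤ leftPerp (isoClass B₁) :=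
  fun M hM => leftPerp_isoClass_iff.2 fun g => by
    rw [Tors.inf_iff] at hM
    rw [← kernel.lift_ι f g (leftPerp_isoClass_iff.1 hM.2 _),
      leftPerp_isoClass_iff.1 hM.1 (kernel.lift f g _), zero_comp]

theorem IsBrick.leftPerp_kernel (hB₁ : IsBrick B₁) {f : B₁ ⟶ B₂} (hf : f ≠ 0) :
    (leftPerp (isoClass (kernel f))).1 B₁ := leftPerp_isoClass_iff.2 fun g => by
  by_contra hg
  have : IsIso (g ≫ kernel.ι f) := hB₁.isIso fun h => hg (zero_of_comp_mono _ h)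
  exact hf (zero_of_epi_comp (g ≫ kernel.ι f) (by simp))

end NonzeroMaps

-- Given `0 ≠ f : B₁ ⟶ B₂`, `T(B₂)` could be replaced by `T(B₂)_*` in the canonical join
-- representation.
theorem cjrBricks_mem_sbrick {T : Tors C} (hT : T ∈ lowerZero (Tors C)) :
    cjrBricks T ∈ sbrick C := by
  obtain ⟨A, hA⟩ := hT
  refine ⟨⟨fun e h => ⟨h.1.of_iso e, isoClass_congr e ▸ h.2⟩⟩, fun _ h => h.1, ?_⟩
  rintro B₁ B₂ ⟨hB₁, hA₁⟩ ⟨hB₂, hA₂⟩ hne f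
  rw [hA.cjr_eq] at hA₁ hA₂
  by_contra hf
  have hmem : torsClosure (isoClass B₁) ∈ A \ {torsClosure (isoClass B₂)} :=
    ⟨hA₁, fun h => hne (iso_of_torsClosure_isoClass_eq hB₁ hB₂ h)⟩
  have hlt := (hA.irreducible hA₂).lowerStar_lt
  exact hlt.not_ge <| hA.le_of_le_sup_sSup_diff hA₂ hlt.le <|
    (torsClosure_isoClass_le_lowerStar_sup hB₂ hf).trans
      (sup_le_sup_left (le_sSup hmem) _)

-- Given `0 ≠ f : B₁ ⟶ B₂`, `⊥B₁` could be replaced by the strictly larger `⊥(ker f)` in the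
-- canonical meet representation.
theorem cmrBricks_mem_sbrick {T : Tors C} (hT : T ∈ upperZero (Tors C)) :
    cmrBricks T ∈ sbrick C := by
  obtain ⟨A, hA⟩ := hT
  refine ⟨⟨fun e h => ⟨h.1.of_iso e, isoClass_congr e ▸ h.2⟩⟩, fun _ h => h.1, ?_⟩
  rintro B₁ B₂ ⟨hB₁, hA₁⟩ ⟨hB₂, hA₂⟩ hne f
  rw [hA.cmr_eq] at hA₁ hA₂
  by_contra hf
  have hmem : leftPerp (isoClass B₂) ∈ A \ {leftPerp (isoClass B₁)} :=
    ⟨hA₂, fun h => hne (iso_of_leftPerp_isoClass_eq hB₁ hB₂ h.symm)⟩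
  have hle : leftPerp (isoClass (kernel f)) ≤ leftPerp (isoClass B₁) :=
    hA.le_of_inf_sInf_diff_le hA₁ (leftPerp_isoClass_le_of_mono (kernel.ι f)) <|
      (inf_le_inf_left _ (sInf_le hmem)).trans (leftPerp_kernel_inf_le f)
  exact hB₁.not_leftPerp (hle B₁ (hB₁.leftPerp_kernel hf))

end CanonicalRepresentations

/-! ### Wide subcategories -/

section FilteredObjects

variable {C : Type u} [Category.{v} C] [Abelian C] {S : ObjectProperty C}

namespace FiltBy

theorem epi_and_kernel (hS : S ∈ sbrick C) {M B : C} (hM : FiltBy S M) (hB : S B) {f : M ⟶ B}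
    (hf : f ≠ 0) : Epi f ∧ FiltBy S (kernel f) := by
  induction hM with
  | zero h => exact absurd (h.eq_zero_of_src f) hf
  | @step E hE h₁ h₃ ih =>
    have := hE.mono_f
    have := hE.epi_g
    by_cases hfac : E.f ≫ f = 0
    · obtain ⟨g, rfl⟩ : ∃ g, f = E.g ≫ g :=
        ⟨hE.exact.desc f hfac, (hE.exact.g_desc f hfac).symm⟩
      have : IsIso g := isIso_of_mem_sbrick hS h₃ hB fun h => hf (by rw [h, comp_zero])
      exact ⟨epi_comp _ _, h₁.of_iso ((kernelIsoX₁ hE).symm ≪≫ (kernelCompMono E.g g).symm)⟩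
    · obtain ⟨_, hker⟩ := ih hfac
      obtain ⟨i, p, w, hK⟩ := shortExact_kernel_comp E.f f
      exact ⟨epi_of_epi E.f f,
        .step hK hker (hS.1.of_iso (cokernelIsoX₃ hE).symm h₃)⟩

theorem kernel_and_cokernel (hS : S ∈ sbrick C) {M N : C} (hM : FiltBy S M) (hN : FiltBy S N)
    (f : M ⟶ N) : FiltBy S (kernel f) ∧ FiltBy S (cokernel f) := by
  induction hN generalizing M with
  | zero h =>
    obtain rfl : f = 0 := h.eq_zero_of_tgt f
    exact ⟨hM.of_iso kernelZeroIsoSource.symm, .of_iso (.zero h) cokernelZeroIsoTarget.symm⟩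
  | @step E hE _ h₃ ih =>
    have := hE.mono_f
    by_cases hfac : f ≫ E.g = 0
    · obtain ⟨g, rfl⟩ : ∃ g, f = g ≫ E.f :=
        ⟨hE.exact.lift f hfac, (hE.exact.lift_f f hfac).symm⟩
      obtain ⟨hker, hcoker⟩ := ih hM g
      obtain ⟨i, p, w, hK⟩ := shortExact_cokernel_comp g E.f
      exact ⟨hker.of_iso (kernelCompMono g E.f).symm,
        .step hK hcoker (hS.1.of_iso (cokernelIsoX₃ hE).symm h₃)⟩
    · -- `f ≫ E.g` is epi, so `f` and its restriction `kernel (f ≫ E.g) ⟶ kernel E.g` have the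
      -- same kernel and cokernel, and the target of the restriction has a shorter filtration.
      obtain ⟨_, hker⟩ := hM.epi_and_kernel hS h₃ hfac
      obtain ⟨t, ⟨e⟩, ⟨e'⟩⟩ := exists_kernel_map_of_epi_comp f E.g
      obtain ⟨hk, hc⟩ := ih hker (t ≫ (kernelIsoX₁ hE).hom)
      exact ⟨hk.of_iso (kernelCompMono t _ ≪≫ e), hc.of_iso (cokernelCompIsIso t _ ≪≫ e')⟩

end FiltBy

theorem filtBy_mem_wide (hS : S ∈ sbrick C) : FiltBy S ∈ wide C := by
  refine ⟨inferInstance, inferInstance, inferInstance, ⟨?_⟩, ⟨?_⟩⟩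
  · rintro _ ⟨f, k, hk, hM, hN⟩
    exact (hM.kernel_and_cokernel hS hN f).1.of_iso
      (IsLimit.conePointUniqueUpToIso (limit.isLimit _) hk)
  · rintro _ ⟨f, k, hk, hM, hN⟩
    exact (hM.kernel_and_cokernel hS hN f).2.of_iso
      (IsColimit.coconePointUniqueUpToIso (colimit.isColimit _) hk)

theorem torsClosure_filtBy : torsClosure (FiltBy S) = torsClosure S :=
  le_antisymm (torsClosure_le_iff.2 (FiltBy.le_of_le (le_torsClosure S)))
    (torsClosure_mono fun _ => .of_prop)

theorem leftPerp_filtBy : leftPerp (FiltBy S) = leftPerp S := by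
  refine le_antisymm (leftPerp_anti fun _ => .of_prop) fun M hM Y f hY => ?_
  induction hY with
  | zero h => exact h.eq_zero_of_tgt f
  | @step E hE _ h₃ ih =>
    have := hE.mono_f
    have hfac : f ≫ E.g = 0 := hM _ h₃
    rw [← hE.exact.lift_f f hfac, ih (hE.exact.lift f hfac), zero_comp]

end FilteredObjects

section SimpleObjects

variable {C : Type u} [Category.{v} C] [Abelian C] {W : ObjectProperty C}

section Kernels

variable [W.ContainsZero] [W.IsClosedUnderKernels] {X Y : C}

theorem simpleObjects_iff : simpleObjects W X ↔ W X ∧ ¬ IsZero X ∧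
    ∀ {Y : C} (f : Y ⟶ X) [Mono f], W Y → ¬ IsZero Y → IsIso f := by
  constructor
  · rintro ⟨hX, _⟩
    refine ⟨hX, fun h => Simple.not_isZero (⟨X, hX⟩ : W.FullSubcategory)
      (.of_full_of_faithful_of_isZero W.ι _ h), fun {Y} f _ hY h0 => ?_⟩
    let g : (⟨Y, hY⟩ : W.FullSubcategory) ⟶ ⟨X, hX⟩ := ObjectProperty.homMk f
    have : Mono g := W.ι.mono_of_mono_map (inferInstanceAs (Mono f))
    have : IsIso g := isIso_of_mono_of_nonzero fun h =>
      h0 (IsZero.of_mono_eq_zero f (congrArg (fun g => g.hom) h))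
    exact inferInstanceAs (IsIso (W.ι.map g))
  · rintro ⟨hX, h0, hmin⟩
    refine ⟨hX, ⟨fun {Y} f _ => ⟨fun _ hf => h0 ?_, fun hf => ?_⟩⟩⟩
    · exact IsZero.of_epi_eq_zero (W.ι.map f) (by rw [hf]; rfl)
    · have hY : ¬ IsZero Y.obj := fun h => hf (by ext; exact h.eq_zero_of_src _)
      have := W.preservesMonomorphisms_ι_of_isNormalEpiCategory
      have : IsIso (W.ι.map f) := hmin (W.ι.map f) Y.2 hY
      exact isIso_of_reflects_iso f W.ι

theorem not_isZero_of_simpleObjects (hX : simpleObjects W X) : ¬ IsZero X :=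
  (simpleObjects_iff.1 hX).2.1

theorem isIso_of_simpleObjects (hX : simpleObjects W X) (hY : simpleObjects W Y) {f : X ⟶ Y}
    (hf : f ≠ 0) : IsIso f := by
  obtain ⟨hXW, hX0, hXmin⟩ := simpleObjects_iff.1 hX
  obtain ⟨hYW, -, hYmin⟩ := simpleObjects_iff.1 hY
  have hker : IsZero (kernel f) := by
    by_contra h
    have := hXmin (kernel.ι f) (W.prop_kernel f hXW hYW) h
    exact hf (zero_of_epi_comp (kernel.ι f) (kernel.condition f))
  have : Mono f := Preadditive.mono_of_isZero_kernel f hker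
  exact hYmin f hXW hX0

theorem simpleObjects_of_iso [W.IsClosedUnderIsomorphisms] (e : X ≅ Y) (hX : simpleObjects W X) :
    simpleObjects W Y := by
  obtain ⟨hXW, hX0, hmin⟩ := simpleObjects_iff.1 hX
  refine simpleObjects_iff.2 ⟨W.prop_of_iso e hXW, fun h => hX0 (h.of_iso e),
    fun f _ hZ h0 => ?_⟩
  have : IsIso (f ≫ e.inv) := hmin _ hZ h0
  exact IsIso.of_isIso_comp_right f e.inv

end Kernels

theorem simpleObjects_mem_sbrick (hW : W ∈ wide C) : simpleObjects W ∈ sbrick C := by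
  obtain ⟨_, _, _, _, _⟩ := hW
  refine ⟨⟨simpleObjects_of_iso⟩, fun B hB => ⟨⟨𝟙 B, 0, fun h => ?_⟩, fun f hf => ?_⟩,
    fun B₁ B₂ h₁ h₂ h f => ?_⟩
  · exact not_isZero_of_simpleObjects hB ((IsZero.iff_id_eq_zero B).2 h)
  · exact (isUnit_iff_isIso f).2 (isIso_of_simpleObjects hB hB hf)
  · by_contra hf
    have := isIso_of_simpleObjects h₁ h₂ hf
    exact h ⟨asIso f⟩

theorem simpleObjects_filtBy {S : ObjectProperty C} (hS : S ∈ sbrick C) :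
    simpleObjects (FiltBy S) = S := by
  have := hS.1
  obtain ⟨_, _, _, _, _⟩ := filtBy_mem_wide hS
  ext B
  rw [simpleObjects_iff]
  constructor
  · rintro ⟨hB, h0, hmin⟩
    cases hB with
    | zero h => exact absurd h h0
    | @step E hE h₁ h₃ =>
      have := hE.mono_f
      have hX₁ : IsZero E.X₁ := by
        by_contra h
        have : IsIso E.f := hmin E.f h₁ h
        exact (hS.2.1 _ h₃).not_isZero (hE.isIso_f_iff.1 this)
      have : IsIso E.g := hE.isIso_g_iff.2 hX₁
      exact S.prop_of_iso (asIso E.g).symm h₃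
  · intro hB
    refine ⟨.of_prop hB, (hS.2.1 B hB).not_isZero, fun {Y} f _ hY h0 => ?_⟩
    have := (hY.epi_and_kernel hS hB fun h => h0 (IsZero.of_mono_eq_zero f h)).1
    exact isIso_of_mono_of_epi f

-- A largest subobject `Q` of `M` filtered by simple objects is all of `M`: otherwise `M / Q`
-- contains a simple object of `W`, whose preimage in `M` would be larger and still filtered.
theorem filtBy_simpleObjects [∀ X : C, IsNoetherianObject X] [∀ X : C, IsArtinianObject X]
    (hW : W ∈ wide C) : FiltBy (simpleObjects W) = W := by
  obtain ⟨_, _, _, _, _⟩ := hW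
  have hle : FiltBy (simpleObjects W) ≤ W := FiltBy.le_of_le fun _ ⟨h, _⟩ => h
  refine le_antisymm hle fun M hM => ?_
  obtain ⟨Q, hQ, hmax⟩ := exists_subobject_no_subobject_cokernel (FiltBy (simpleObjects W)) M
  have hcoker : IsZero (cokernel Q.arrow) := by
    by_contra h0
    obtain ⟨I, hI, hI0, hmin⟩ := exists_nonzero_subobject_isIso_of_mono W
      (W.prop_cokernel Q.arrow (hle _ hQ) hM) h0
    have hsimple : simpleObjects W (I : C) := simpleObjects_iff.2 ⟨hI, hI0, hmin⟩
    exact hI0 (IsZero.of_mono_eq_zero I.arrow (hmax I.arrow (.of_prop hsimple)))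
  have : Epi Q.arrow := Preadditive.epi_of_isZero_cokernel _ hcoker
  have := isIso_of_mono_of_epi Q.arrow
  exact hQ.of_iso (asIso Q.arrow)

end SimpleObjects

/-! ### The bijections -/

section Bijections

variable {C : Type u} [Category.{v} C] [Abelian C]

theorem torsClosure_filt {S : ObjectProperty C} [S.IsClosedUnderIsomorphisms] :
    torsClosure (filt S) = torsClosure S := by
  rw [filt_eq_filtBy, torsClosure_filtBy]

theorem leftPerp_filt {S : ObjectProperty C} [S.IsClosedUnderIsomorphisms] :
    leftPerp (filt S) = leftPerp S := by
  rw [filt_eq_filtBy, leftPerp_filtBy]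

theorem filt_mem_wide {S : ObjectProperty C} (hS : S ∈ sbrick C) : filt S ∈ wide C := by
  have := hS.1
  exact filt_eq_filtBy (P := S) ▸ filtBy_mem_wide hS

theorem simpleObjects_filt {S : ObjectProperty C} (hS : S ∈ sbrick C) :
    simpleObjects (filt S) = S := by
  have := hS.1
  rw [filt_eq_filtBy, simpleObjects_filtBy hS]

theorem torsClosure_mem_lowerZero {S : ObjectProperty C} (hS : S ∈ sbrick C) :
    torsClosure S ∈ lowerZero (Tors C) :=
  ⟨_, isCanonicalJoinRep_torsClosure hS⟩

variable [∀ X : C, IsNoetherianObject X]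

theorem leftPerp_mem_upperZero {S : ObjectProperty C} (hS : S ∈ sbrick C) :
    leftPerp S ∈ upperZero (Tors C) :=
  ⟨_, isCanonicalMeetRep_leftPerp hS⟩

variable [∀ X : C, IsArtinianObject X]

theorem filt_simpleObjects {W : ObjectProperty C} (hW : W ∈ wide C) :
    filt (simpleObjects W) = W := by
  have := (simpleObjects_mem_sbrick hW).1
  rw [filt_eq_filtBy, filtBy_simpleObjects hW]

theorem torsClosure_simpleObjects {W : ObjectProperty C} (hW : W ∈ wide C) :
    torsClosure (simpleObjects W) = torsClosure W := by
  rw [← torsClosure_filtBy, filtBy_simpleObjects hW]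

theorem leftPerp_simpleObjects {W : ObjectProperty C} (hW : W ∈ wide C) :
    leftPerp (simpleObjects W) = leftPerp W := by
  rw [← leftPerp_filtBy, filtBy_simpleObjects hW]

theorem extKappa_torsClosure_of_mem_wide {W : ObjectProperty C} (hW : W ∈ wide C) :
    extKappa (torsClosure W) = leftPerp W := by
  rw [← torsClosure_simpleObjects hW, ← leftPerp_simpleObjects hW,
    extKappa_torsClosure (simpleObjects_mem_sbrick hW)]

theorem extKappa_eq_leftPerp_cjrBricks {T : Tors C} (hT : T ∈ lowerZero (Tors C)) :
    extKappa T = leftPerp (cjrBricks T) := by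
  conv_lhs => rw [← torsClosure_cjrBricks hT]
  exact extKappa_torsClosure (cjrBricks_mem_sbrick hT)

theorem cmrBricks_extKappa {T : Tors C} (hT : T ∈ lowerZero (Tors C)) :
    cmrBricks (extKappa T) = cjrBricks T := by
  rw [extKappa_eq_leftPerp_cjrBricks hT, cmrBricks_leftPerp (cjrBricks_mem_sbrick hT)]

variable (C)

theorem invOn_cjrBricks_torsClosure :
    Set.InvOn cjrBricks torsClosure (sbrick C) (lowerZero (Tors C)) :=
  ⟨fun _ => cjrBricks_torsClosure, fun _ => torsClosure_cjrBricks⟩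

theorem invOn_cmrBricks_leftPerp :
    Set.InvOn cmrBricks leftPerp (sbrick C) (upperZero (Tors C)) :=
  ⟨fun _ => cmrBricks_leftPerp, fun _ => leftPerp_cmrBricks⟩

theorem invOn_simpleObjects_filt : Set.InvOn simpleObjects filt (sbrick C) (wide C) :=
  ⟨fun _ => simpleObjects_filt, fun _ => filt_simpleObjects⟩

theorem bijOn_torsClosure_sbrick : Set.BijOn torsClosure (sbrick C) (lowerZero (Tors C)) :=
  (invOn_cjrBricks_torsClosure C).bijOn (fun _ => torsClosure_mem_lowerZero)
    fun _ => cjrBricks_mem_sbrick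

theorem bijOn_cjrBricks : Set.BijOn cjrBricks (lowerZero (Tors C)) (sbrick C) :=
  .symm (invOn_cjrBricks_torsClosure C).symm (bijOn_torsClosure_sbrick C)

theorem bijOn_leftPerp_sbrick : Set.BijOn leftPerp (sbrick C) (upperZero (Tors C)) :=
  (invOn_cmrBricks_leftPerp C).bijOn (fun _ => leftPerp_mem_upperZero)
    fun _ => cmrBricks_mem_sbrick

theorem bijOn_cmrBricks : Set.BijOn cmrBricks (upperZero (Tors C)) (sbrick C) :=
  .symm (invOn_cmrBricks_leftPerp C).symm (bijOn_leftPerp_sbrick C)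

theorem bijOn_filt : Set.BijOn filt (sbrick C) (wide C) :=
  (invOn_simpleObjects_filt C).bijOn (fun _ => filt_mem_wide) fun _ => simpleObjects_mem_sbrick

theorem bijOn_simpleObjects : Set.BijOn simpleObjects (wide C) (sbrick C) :=
  .symm (invOn_simpleObjects_filt C).symm (bijOn_filt C)

theorem bijOn_torsClosure_wide : Set.BijOn torsClosure (wide C) (lowerZero (Tors C)) :=
  ((bijOn_torsClosure_sbrick C).comp (bijOn_simpleObjects C)).congr
    fun _ => torsClosure_simpleObjects

theorem bijOn_leftPerp_wide : Set.BijOn leftPerp (wide C) (upperZero (Tors C)) :=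
  ((bijOn_leftPerp_sbrick C).comp (bijOn_simpleObjects C)).congr fun _ => leftPerp_simpleObjects

theorem bijOn_extKappa : Set.BijOn extKappa (lowerZero (Tors C)) (upperZero (Tors C)) :=
  ((bijOn_leftPerp_sbrick C).comp (bijOn_cjrBricks C)).congr
    fun _ hT => (extKappa_eq_leftPerp_cjrBricks hT).symm

end Bijections

end TorsKappa

theorem theorem4 {C : Type u} [Category.{v} C] [Abelian C] (hC : IsLengthCategory C) :
    -- the kappa map is well defined on `tors C`: the maximum in its definition exists
    (∀ j : Tors C, IsCompletelyJoinIrreducible j →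
      IsGreatest {x : Tors C | j ⊓ x = lowerStar j} (kappa j)) ∧
    -- the extended kappa map is a bijection
    Set.BijOn extKappa (lowerZero (Tors C)) (upperZero (Tors C)) ∧
    -- `T` and the brick version of `CJR` are mutually inverse bijections
    Set.BijOn torsClosure (sbrick C) (lowerZero (Tors C)) ∧
    Set.BijOn cjrBricks (lowerZero (Tors C)) (sbrick C) ∧
    Set.InvOn cjrBricks torsClosure (sbrick C) (lowerZero (Tors C)) ∧
    -- `⊥(-)` and the brick version of `CMR` are mutually inverse bijections
    Set.BijOn leftPerp (sbrick C) (upperZero (Tors C)) ∧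
    Set.BijOn cmrBricks (upperZero (Tors C)) (sbrick C) ∧
    Set.InvOn cmrBricks leftPerp (sbrick C) (upperZero (Tors C)) ∧
    -- `Filt` and `simp` are mutually inverse bijections
    Set.BijOn filt (sbrick C) (wide C) ∧
    Set.BijOn simpleObjects (wide C) (sbrick C) ∧
    Set.InvOn simpleObjects filt (sbrick C) (wide C) ∧
    -- `T` and `⊥(-)` are bijections on wide subcategories
    Set.BijOn torsClosure (wide C) (lowerZero (Tors C)) ∧
    Set.BijOn leftPerp (wide C) (upperZero (Tors C)) ∧
    -- the two triangles between semibricks and wide subcategories commute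
    (∀ S ∈ sbrick C, torsClosure (filt S) = torsClosure S ∧ leftPerp (filt S) = leftPerp S) ∧
    (∀ W ∈ wide C, torsClosure (simpleObjects W) = torsClosure W ∧
      leftPerp (simpleObjects W) = leftPerp W) ∧
    -- the triangle of the extended kappa map commutes
    (∀ T ∈ lowerZero (Tors C), extKappa T = leftPerp (cjrBricks T) ∧
      cmrBricks (extKappa T) = cjrBricks T) ∧
    (∀ S ∈ sbrick C, extKappa (torsClosure S) = leftPerp S) ∧
    (∀ W ∈ wide C, extKappa (torsClosure W) = leftPerp W) := by
  have (X : C) := hC.isNoetherianObject X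
  have (X : C) := hC.isArtinianObject X
  exact ⟨fun _ => isGreatest_kappa, bijOn_extKappa C,
    bijOn_torsClosure_sbrick C, bijOn_cjrBricks C, invOn_cjrBricks_torsClosure C,
    bijOn_leftPerp_sbrick C, bijOn_cmrBricks C, invOn_cmrBricks_leftPerp C,
    bijOn_filt C, bijOn_simpleObjects C, invOn_simpleObjects_filt C,
    bijOn_torsClosure_wide C, bijOn_leftPerp_wide C,
    fun _ ⟨_, _⟩ => ⟨torsClosure_filt, leftPerp_filt⟩,
    fun _ hW => ⟨torsClosure_simpleObjects hW, leftPerp_simpleObjects hW⟩,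
    fun _ hT => ⟨extKappa_eq_leftPerp_cjrBricks hT, cmrBricks_extKappa hT⟩,
    fun _ => extKappa_torsClosure, fun _ => extKappa_torsClosure_of_mem_wide⟩
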